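/- Let $\mathbb{F}$ be a non-archimedean local field, $n \ge 0$ an integer, and let $G$ be a closed subgroup of $GL(n,\mathbb{F})$, with the topology induced from $GL(n,\mathbb{F})$, which is compactly generated, i.e. generated as a group by some compact subset. For $g \in G$ let $$C_g = \{x \in G : \lim_{k \to \infty} g^k x g^{-k} = e\}$$ be the contraction subgroup of $g$ in $G$, where $e$ is the identity of $G$. Suppose that $C_g = \{e\}$ for every $g \in G$. Then the compact open normal subgroups of $G$ form a basis of neighbourhoods of $e$ in $G$: each such subgroup is a neighbourhood of $e$, and every neighbourhood of $e$ in $G$ contains a compact open normal subgroup of $G$. -/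

import Mathlib

open Filter Topology

/-- The contraction subgroup `C_g = {x ∈ G ∣ g ^ n * x * g ^ (-n) → 1 as n → ∞}` of an element `g`
of a topological group `G`. -/
def contractionSubgroup {G : Type*} [Group G] [TopologicalSpace G] [IsTopologicalGroup G]
    (g : G) : Subgroup G where
  carrier := {x | Tendsto (fun n : ℕ => g ^ n * x * (g ^ n)⁻¹) atTop (𝓝 1)}
  one_mem' := by simp [tendsto_const_nhds]
  mul_mem' := by
    intro a b ha hb
    have h := Tendsto.mul (Set.mem_ofPred_eq ▸ ha) (Set.mem_ofPred_eq ▸ hb)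
    simpa [mul_assoc] using h
  inv_mem' := by
    intro a ha
    have h := Tendsto.inv (Set.mem_ofPred_eq ▸ ha)
    simpa [mul_assoc] using h

/-- A topological group is compactly generated if some compact subset generates it as an abstract
group. -/
def IsCompactlyGeneratedGroup (G : Type*) [Group G] [TopologicalSpace G] : Prop :=
  ∃ S : Set G, IsCompact S ∧ Subgroup.closure S = ⊤

/-! Let `G` act by conjugation on the matrix algebra `R`. Triviality of the contraction groups
enters twice. If `x ∈ G` has bounded forward orbit under `g`, an idempotent limit of powers of
conjugation splits off a contracted factor of `x`; this factor is trivial, so `x` is recurrent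
(`mem_closure_orbit_of_mem_boundedOrbits`). If points arbitrarily near `1` had unbounded orbits, the
limit of their first exits from a small lattice would have a backward orbit staying inside it,
against recurrence for `g⁻¹` (`eventually_mem_boundedOrbits`).

Let `V` be the smallest span of the `x - 1` for `x` near `1`. It is stable under conjugation and
products, and each `g` acts on it with bounded powers. A Burnside-type argument shows that such a
representation is bounded or reducible. By induction on dimension, a bounded family of operators,
such as those of a compact generating set, then stabilizes a lattice `L`
(`exists_isLattice_mapsTo_of_isPowerBounded`). For small `t`, the `x ∈ G` with `x` and `x⁻¹` in `1 +
tL` form the required subgroups. -/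

/-! ### Lattices and power bounded operators -/

section Lattice

variable {𝕜 V : Type*} [NontriviallyNormedField 𝕜] [NormedAddCommGroup V] [NormedSpace 𝕜 V]

variable (𝕜) in
/-- A lattice: an open bounded additive subgroup stable under scalars of norm at most one. -/
structure IsLattice (L : AddSubgroup V) : Prop where
  isOpen : IsOpen (L : Set V)
  isBounded : Bornology.IsBounded (L : Set V)
  smul_mem : ∀ (c : 𝕜) (v : V), ‖c‖ ≤ 1 → v ∈ L → c • v ∈ L

/-- An endomorphism with bounded positive powers. -/
def IsPowerBounded (T : V →L[𝕜] V) : Prop := ∃ C : ℝ, ∀ n : ℕ, ‖T ^ n‖ ≤ C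

namespace IsLattice

variable {L : AddSubgroup V}

theorem isClosed (hL : IsLattice 𝕜 L) : IsClosed (L : Set V) :=
  L.isClosed_of_isOpen hL.isOpen

theorem exists_ball_subset (hL : IsLattice 𝕜 L) : ∃ δ > 0, ∀ v : V, ‖v‖ < δ → v ∈ L := by
  obtain ⟨δ, hδ, h⟩ := Metric.mem_nhds_iff.1 (hL.isOpen.mem_nhds L.zero_mem)
  exact ⟨δ, hδ, fun v hv => h (by simpa using hv)⟩

theorem exists_norm_le (hL : IsLattice 𝕜 L) : ∃ C > 0, ∀ v ∈ L, ‖v‖ ≤ C := by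
  obtain ⟨C, hC, h⟩ := hL.isBounded.exists_pos_norm_le
  exact ⟨C, hC, h⟩

theorem of_ball_subset {δ C : ℝ} (hδ : 0 < δ) (h : ∀ v : V, ‖v‖ < δ → v ∈ L)
    (hC : ∀ v ∈ L, ‖v‖ ≤ C) (hsmul : ∀ (c : 𝕜) (v : V), ‖c‖ ≤ 1 → v ∈ L → c • v ∈ L) :
    IsLattice 𝕜 L where
  isOpen := L.isOpen_of_mem_nhds (g := 0)
    (Metric.mem_nhds_iff.2 ⟨δ, hδ, fun v hv => h v (by simpa using hv)⟩)
  isBounded := isBounded_iff_forall_norm_le.2 ⟨C, hC⟩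
  smul_mem := hsmul

variable (L) in
/-- The additive subgroup `t • L`, for a nonzero scalar `t`. -/
def scale (t : 𝕜) : AddSubgroup V := L.comap (DistribSMul.toAddMonoidHom V t⁻¹)

theorem mem_scale {t : 𝕜} {v : V} : v ∈ scale L t ↔ t⁻¹ • v ∈ L := Iff.rfl

theorem scale_isLattice (hL : IsLattice 𝕜 L) {t : 𝕜} (ht : t ≠ 0) : IsLattice 𝕜 (scale L t) := by
  obtain ⟨δ, hδ, h⟩ := hL.exists_ball_subset
  obtain ⟨C, hC, h'⟩ := hL.exists_norm_le
  have ht' : 0 < ‖t‖ := norm_pos_iff.2 ht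
  refine of_ball_subset (δ := ‖t‖ * δ) (C := ‖t‖ * C) (by positivity) (fun v hv => ?_)
    (fun v hv => ?_) fun c v hc hv => ?_
  · refine h (t⁻¹ • v) ?_
    rw [norm_smul, norm_inv, inv_mul_lt_iff₀ ht']
    exact hv
  · have := h' _ hv
    change ‖t⁻¹ • v‖ ≤ C at this
    rwa [norm_smul, norm_inv, inv_mul_le_iff₀ ht'] at this
  · rw [mem_scale, smul_comm]
    exact hL.smul_mem c _ hc hv

theorem eventually_smul_mem (hL : IsLattice 𝕜 L) (C : ℝ) :
    ∀ᶠ t : 𝕜 in 𝓝 0, ∀ v : V, ‖v‖ ≤ C → t • v ∈ L := by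
  obtain ⟨δ, hδ, h⟩ := hL.exists_ball_subset
  have : Tendsto (fun t : 𝕜 => ‖t‖ * C) (𝓝 0) (𝓝 0) := by
    have : Continuous (fun t : 𝕜 => ‖t‖ * C) := by fun_prop
    simpa using this.tendsto 0
  filter_upwards [this.eventually_lt_const hδ] with t ht v hv
  refine h _ ?_
  rw [norm_smul]
  exact (mul_le_mul_of_nonneg_left hv (norm_nonneg _)).trans_lt ht

theorem exists_norm_le_of_mapsTo (hL : IsLattice 𝕜 L) :
    ∃ C : ℝ, ∀ T : V →L[𝕜] V, (∀ v ∈ L, T v ∈ L) → ‖T‖ ≤ C := by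
  obtain ⟨δ, hδ, h⟩ := hL.exists_ball_subset
  obtain ⟨C, hC, h'⟩ := hL.exists_norm_le
  obtain ⟨c, hc⟩ := NormedField.exists_one_lt_norm 𝕜
  refine ⟨C * (‖c‖ / δ), fun T hT => ?_⟩
  have hc0 : 0 < ‖c‖ := by linarith
  refine T.opNorm_le_of_shell hδ (by positivity) hc fun v hv1 hv2 => ?_
  have h1 : 1 ≤ ‖c‖ / δ * ‖v‖ := by
    have : δ ≤ ‖v‖ * ‖c‖ := (div_le_iff₀ hc0).1 hv1
    rw [div_mul_eq_mul_div, le_div_iff₀ hδ]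
    linarith
  calc ‖T v‖ ≤ C := h' _ (hT _ (h _ hv2))
    _ ≤ C * (‖c‖ / δ * ‖v‖) := le_mul_of_one_le_right hC.le h1
    _ = _ := by ring

theorem isPowerBounded_of_mapsTo (hL : IsLattice 𝕜 L) {T : V →L[𝕜] V} (hT : ∀ v ∈ L, T v ∈ L) :
    IsPowerBounded T := by
  obtain ⟨C, hC⟩ := hL.exists_norm_le_of_mapsTo
  refine ⟨C, fun n => hC _ ?_⟩
  induction n with
  | zero => simp
  | succ n ih => intro v hv; rw [pow_succ]; exact ih _ (hT v hv)

end IsLattice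

variable (𝕜 V) in
theorem exists_isLattice [IsUltrametricDist 𝕜] [CompleteSpace 𝕜] [FiniteDimensional 𝕜 V] :
    ∃ L : AddSubgroup V, IsLattice 𝕜 L := by
  let e : V ≃L[𝕜] (Fin (Module.finrank 𝕜 V) → 𝕜) :=
    ContinuousLinearEquiv.ofFinrankEq (by simp)
  let L : AddSubgroup V :=
    { carrier := {v | ∀ i, ‖e v i‖ ≤ 1}
      zero_mem' := by simp
      add_mem' := by
        intro a b ha hb i
        rw [map_add]
        exact (IsUltrametricDist.norm_add_le_max _ _).trans (max_le (ha i) (hb i))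
      neg_mem' := by
        intro a ha i
        rw [map_neg, Pi.neg_apply, norm_neg]
        exact ha i }
  have hLe : (L : Set V) = e ⁻¹' Metric.closedBall 0 1 := by
    ext v
    simp [L, pi_norm_le_iff_of_nonneg]
  refine ⟨L, ?_, ?_, ?_⟩
  · refine L.isOpen_of_mem_nhds (g := 0) ?_
    rw [hLe]
    exact e.continuous.continuousAt.preimage_mem_nhds (by
      rw [map_zero]; exact Metric.closedBall_mem_nhds _ one_pos)
  · rw [hLe, ← e.image_symm_eq_preimage]
    exact e.symm.toContinuousLinearMap.lipschitz.isBounded_image Metric.isBounded_closedBall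
  · intro c v hc hv i
    rw [map_smul, Pi.smul_apply, norm_smul]
    exact mul_le_one₀ hc (norm_nonneg _) (hv i)

/-- Intersect the preimages of one lattice under all `ρ m`: the uniform bound leaves a ball inside,
and `m = 1` keeps the intersection bounded. -/
theorem exists_isLattice_mapsTo_of_bounded [IsUltrametricDist 𝕜] [CompleteSpace 𝕜]
    [FiniteDimensional 𝕜 V] {M : Type*} [Monoid M] (ρ : M →* (V →L[𝕜] V))
    (h : ∃ C : ℝ, ∀ m, ‖ρ m‖ ≤ C) :
    ∃ L : AddSubgroup V, IsLattice 𝕜 L ∧ ∀ m, ∀ v ∈ L, ρ m v ∈ L := by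
  obtain ⟨L₀, hL₀⟩ := exists_isLattice 𝕜 V
  obtain ⟨C, hC⟩ := h
  obtain ⟨δ, hδ, h⟩ := hL₀.exists_ball_subset
  obtain ⟨B, hB, h'⟩ := hL₀.exists_norm_le
  have hC0 : 0 ≤ C := (norm_nonneg _).trans (hC 1)
  let L : AddSubgroup V := ⨅ m, L₀.comap ((ρ m).toLinearMap.toAddMonoidHom)
  have hmem : ∀ v, v ∈ L ↔ ∀ m, ρ m v ∈ L₀ := fun v => by simp [L, AddSubgroup.mem_iInf]
  refine ⟨L, .of_ball_subset (δ := δ / (C + 1)) (C := B) (by positivity) (fun v hv => ?_)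
    (fun v hv => ?_) (fun c v hc hv => ?_), fun m v hv => ?_⟩
  · rw [hmem]
    refine fun m => h _ ?_
    rw [lt_div_iff₀ (by positivity)] at hv
    calc ‖ρ m v‖ ≤ C * ‖v‖ := (ρ m).le_of_opNorm_le (hC m) v
      _ ≤ ‖v‖ * (C + 1) := by nlinarith [norm_nonneg v]
      _ < δ := hv
  · have := (hmem v).1 hv 1
    rw [map_one] at this
    exact h' _ this
  · rw [hmem] at hv ⊢
    intro m
    rw [map_smul]
    exact hL₀.smul_mem _ _ hc (hv m)
  · rw [hmem] at hv ⊢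
    intro m'
    have := hv (m' * m)
    rwa [map_mul] at this

theorem IsPowerBounded.exists_isLattice_mapsTo [IsUltrametricDist 𝕜] [CompleteSpace 𝕜]
    [FiniteDimensional 𝕜 V] {T : V →L[𝕜] V} (hT : IsPowerBounded T) :
    ∃ L : AddSubgroup V, IsLattice 𝕜 L ∧ ∀ v ∈ L, T v ∈ L := by
  obtain ⟨C, hC⟩ := hT
  obtain ⟨L, hL, h⟩ := exists_isLattice_mapsTo_of_bounded (powersHom _ T) ⟨C, fun m => hC m.toAdd⟩
  exact ⟨L, hL, fun v hv => by simpa using h (Multiplicative.ofAdd 1) v hv⟩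

/-- The powers of `T.det` are determinants of operators in a fixed compact ball, hence bounded. -/
theorem IsPowerBounded.norm_det_le_one [ProperSpace 𝕜] [FiniteDimensional 𝕜 V]
    {T : V →L[𝕜] V} (hT : IsPowerBounded T) : ‖T.det‖ ≤ 1 := by
  obtain ⟨C, hC⟩ := hT
  have : ProperSpace (V →L[𝕜] V) := FiniteDimensional.proper 𝕜 _
  obtain ⟨B, hB⟩ := ((isCompact_closedBall (0 : V →L[𝕜] V) C).image
    ContinuousLinearMap.continuous_det).isBounded.exists_norm_le
  by_contra! hlt
  obtain ⟨n, hn⟩ := pow_unbounded_of_one_lt B hlt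
  refine hn.not_ge ?_
  have := hB _ ⟨T ^ n, by simpa using hC n, rfl⟩
  change ‖LinearMap.det ((T ^ n : V →L[𝕜] V) : V →ₗ[𝕜] V)‖ ≤ B at this
  rwa [ContinuousLinearMap.toLinearMap_pow, map_pow, norm_pow] at this

/-- A lattice stable under `T` is stable under `1 - c • T`. Unlike a bound on the powers of `T`,
which depends on `T`, this determinant bound is uniform and closed, so it survives limits. -/
theorem IsPowerBounded.norm_det_one_sub_smul_le_one [IsUltrametricDist 𝕜] [ProperSpace 𝕜]
    [FiniteDimensional 𝕜 V] {T : V →L[𝕜] V} (hT : IsPowerBounded T) {c : 𝕜} (hc : ‖c‖ ≤ 1) :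
    ‖(1 - c • T).det‖ ≤ 1 := by
  obtain ⟨L, hL, h⟩ := hT.exists_isLattice_mapsTo
  refine (hL.isPowerBounded_of_mapsTo fun v hv => ?_).norm_det_le_one
  exact L.sub_mem hv (hL.smul_mem _ _ hc (h v hv))

end Lattice

/-! ### Power bounded representations are bounded or reducible -/

section BoundedRepresentation

variable {𝕜 V : Type*} [NontriviallyNormedField 𝕜] [NormedAddCommGroup V] [NormedSpace 𝕜 V]

/-- The characteristic polynomial at `c` equals `c ^ d * det (1 - c⁻¹ p)`, so it is at most `‖c‖ ^
d`. It therefore vanishes to order `d` at `0`, and Cayley–Hamilton applies. -/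
theorem isNilpotent_of_norm_det_one_sub_smul_le_one [FiniteDimensional 𝕜 V] (p : V →L[𝕜] V)
    (hp : ∀ c : 𝕜, ‖(1 - c • p).det‖ ≤ 1) : IsNilpotent (p : V →ₗ[𝕜] V) := by
  set f : V →ₗ[𝕜] V := p.toLinearMap with hf
  set d := Module.finrank 𝕜 V
  have hne : f.charpoly ≠ 0 := f.charpoly_monic.ne_zero
  obtain ⟨Q, hQ, hQ0⟩ := Polynomial.exists_eq_pow_rootMultiplicity_mul_and_not_dvd f.charpoly hne 0
  set m := f.charpoly.rootMultiplicity 0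
  rw [map_zero, sub_zero] at hQ hQ0
  rw [Polynomial.X_dvd_iff, Polynomial.coeff_zero_eq_eval_zero] at hQ0
  have hQne : Q ≠ 0 := by rintro rfl; simp at hQ0
  have hdeg : m + Q.natDegree = d := by
    have := f.charpoly_natDegree
    rwa [hQ, Polynomial.natDegree_mul (by simp) hQne, Polynomial.natDegree_X_pow] at this
  have hbound : ∀ c : 𝕜, c ≠ 0 → ‖Q.eval c‖ ≤ ‖c‖ ^ (d - m) := by
    intro c hc
    have h1 : f.charpoly.eval c = c ^ d * (1 - c⁻¹ • p).det := by
      rw [LinearMap.eval_charpoly]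
      change _ = c ^ d * LinearMap.det ((1 - c⁻¹ • p : V →L[𝕜] V) : V →ₗ[𝕜] V)
      rw [← LinearMap.det_smul]
      congr 1
      ext v
      simp [smul_sub, smul_smul, hc, hf, Module.algebraMap_end_apply]
    have h2 : ‖f.charpoly.eval c‖ ≤ ‖c‖ ^ d := by
      rw [h1, norm_mul, norm_pow]
      exact mul_le_of_le_one_right (by positivity) (hp _)
    rw [hQ, Polynomial.eval_mul, Polynomial.eval_pow, Polynomial.eval_X, norm_mul, norm_pow,
      show d = m + (d - m) by omega, pow_add] at h2
    exact le_of_mul_le_mul_left h2 (by positivity)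
  have hmd : m = d := by
    by_contra hmd
    have hpos : d - m ≠ 0 := by omega
    refine hQ0 ?_
    have ht1 : Tendsto (fun c : 𝕜 => ‖Q.eval c‖) (𝓝[≠] 0) (𝓝 ‖Q.eval 0‖) :=
      (Q.continuous.norm.tendsto 0).mono_left nhdsWithin_le_nhds
    have ht2 : Tendsto (fun c : 𝕜 => ‖c‖ ^ (d - m)) (𝓝[≠] 0) (𝓝 0) := by
      have : Continuous fun c : 𝕜 => ‖c‖ ^ (d - m) := by fun_prop
      simpa [hpos] using (this.tendsto 0).mono_left nhdsWithin_le_nhds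
    have := le_of_tendsto_of_tendsto ht1 ht2
      (eventually_nhdsWithin_of_forall fun c hc => hbound c hc)
    simpa using this
  have hQC : Q = Polynomial.C (Q.coeff 0) := Polynomial.eq_C_of_natDegree_eq_zero (by omega)
  have hq0 : Q.coeff 0 ≠ 0 := by rwa [Polynomial.coeff_zero_eq_eval_zero]
  have haev := f.aeval_self_charpoly
  rw [hQ, hQC, map_mul, map_pow, Polynomial.aeval_X, Polynomial.aeval_C,
    Algebra.algebraMap_eq_smul_one, mul_smul_comm, mul_one, smul_eq_zero] at haev
  exact ⟨m, haev.resolve_left hq0⟩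

variable {G : Type*} [Group G]

/-- The limits of `c • ρ g` as the scalar `c` tends to zero. -/
def degenerateLimits (ρ : G →* (V →L[𝕜] V)) : Set (V →L[𝕜] V) :=
  {p | ∀ ε > 0, p ∈ closure {x | ∃ (c : 𝕜) (g : G), ‖c‖ < ε ∧ x = c • ρ g}}

variable {ρ : G →* (V →L[𝕜] V)}

theorem mul_mem_degenerateLimits {p q : V →L[𝕜] V} (hp : p ∈ degenerateLimits ρ)
    (hq : q ∈ degenerateLimits ρ) : p * q ∈ degenerateLimits ρ := by
  intro ε hε
  refine map_mem_closure₂ continuous_mul (hp (min ε 1) (by positivity))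
    (hq (min ε 1) (by positivity)) ?_
  rintro _ ⟨c, g, hc, rfl⟩ _ ⟨c', g', hc', rfl⟩
  refine ⟨c * c', g * g', ?_, by rw [smul_mul_smul_comm, map_mul]⟩
  rw [lt_min_iff] at hc hc'
  rw [norm_mul]
  nlinarith [norm_nonneg c, norm_nonneg c']

theorem mul_map_mem_degenerateLimits {p : V →L[𝕜] V} (hp : p ∈ degenerateLimits ρ) (g : G) :
    p * ρ g ∈ degenerateLimits ρ := by
  intro ε hε
  refine map_mem_closure (f := fun x => x * ρ g) (by fun_prop) (hp ε hε) ?_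
  rintro _ ⟨c, g', hc, rfl⟩
  exact ⟨c, g' * g, hc, by simp only [map_mul, smul_mul_assoc]⟩

theorem isNilpotent_of_mem_degenerateLimits [IsUltrametricDist 𝕜] [ProperSpace 𝕜]
    [FiniteDimensional 𝕜 V] (hρ : ∀ g, IsPowerBounded (ρ g)) {p : V →L[𝕜] V}
    (hp : p ∈ degenerateLimits ρ) : IsNilpotent (p : V →ₗ[𝕜] V) := by
  refine isNilpotent_of_norm_det_one_sub_smul_le_one p fun c => ?_
  have hcont : Continuous fun x : V →L[𝕜] V => (1 - c • x).det :=
    ContinuousLinearMap.continuous_det.comp (by fun_prop)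
  have := map_mem_closure (t := Metric.closedBall 0 1) hcont
    -- With `‖c'‖` below this threshold, `c * c'` has norm at most one.
    (hp (‖c‖ + 1)⁻¹ (by positivity)) ?_
  · rw [Metric.isClosed_closedBall.closure_eq] at this
    simpa using this
  rintro _ ⟨c', g, hc', rfl⟩
  rw [mem_closedBall_zero_iff]
  change ‖(1 - c • c' • ρ g).det‖ ≤ 1
  rw [smul_smul]
  refine (hρ g).norm_det_one_sub_smul_le_one ?_
  have hlt : ‖c'‖ * (‖c‖ + 1) < 1 := by
    calc ‖c'‖ * (‖c‖ + 1) < (‖c‖ + 1)⁻¹ * (‖c‖ + 1) := by gcongr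
      _ = 1 := inv_mul_cancel₀ (by positivity)
  rw [norm_mul]
  nlinarith [norm_nonneg c']

/-- A representation on a finite-dimensional space all of whose elements are power bounded is
bounded, or has a proper nonzero invariant subspace. -/
theorem bounded_or_exists_invariant_submodule [IsUltrametricDist 𝕜] [ProperSpace 𝕜]
    [FiniteDimensional 𝕜 V] (hρ : ∀ g, IsPowerBounded (ρ g)) :
    (∃ C : ℝ, ∀ g, ‖ρ g‖ ≤ C) ∨
      ∃ W : Submodule 𝕜 V, W ≠ ⊥ ∧ W ≠ ⊤ ∧ ∀ g, ∀ w ∈ W, ρ g w ∈ W := by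
  refine or_iff_not_imp_left.2 fun hunb => ?_
  push Not at hunb
  have : ProperSpace (V →L[𝕜] V) := FiniteDimensional.proper 𝕜 _
  -- Rescale an unbounded sequence `ρ (g k)` into a compact shell away from `0`; the scalars used
  -- tend to `0`.
  have hex : ∃ p ∈ degenerateLimits ρ, p ≠ 0 := by
    obtain ⟨a, ha⟩ := NormedField.exists_one_lt_norm 𝕜
    have ha0 : 0 < ‖a‖ := by linarith
    choose g hg using fun k : ℕ => hunb (k + 1)
    have hg0 : ∀ k, ρ (g k) ≠ 0 := fun k h => by
      have := hg k
      rw [h, norm_zero] at this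
      have : (0 : ℝ) ≤ k := k.cast_nonneg
      linarith
    choose c hc0 hc1 hc2 hc3 using fun k => rescale_to_shell ha one_pos (hg0 k)
    have hcomp : IsCompact (Metric.closedBall (0 : V →L[𝕜] V) 1 \ Metric.ball 0 (1 / ‖a‖)) :=
      (isCompact_closedBall 0 1).diff Metric.isOpen_ball
    obtain ⟨p, hp, φ, hφ, hlim⟩ := hcomp.tendsto_subseq (x := fun k => c k • ρ (g k)) fun k =>
      ⟨by simpa using (hc1 k).le, by simpa using hc2 k⟩
    refine ⟨p, fun ε hε => ?_, ?_⟩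
    · refine mem_closure_of_tendsto hlim ?_
      have : Tendsto (fun k : ℕ => 1 / ((k : ℝ) + 1)) atTop (𝓝 0) :=
        tendsto_one_div_add_atTop_nhds_zero_nat
      filter_upwards [(this.comp hφ.tendsto_atTop).eventually_lt_const hε] with k hk
      refine ⟨_, _, lt_of_le_of_lt ?_ hk, rfl⟩
      have h1 := hc1 (φ k)
      have h2 := hg (φ k)
      rw [norm_smul] at h1
      simp only [Function.comp_apply]
      rw [le_div_iff₀ (by positivity)]
      nlinarith [norm_nonneg (c (φ k))]
    · rintro rfl
      exact hp.2 (by simpa using ha0)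
  obtain ⟨p, ⟨hpS, hp0⟩, hmin⟩ := exists_minimalFor_of_wellFoundedLT
    (fun p : V →L[𝕜] V => p ∈ degenerateLimits ρ ∧ p ≠ 0)
    (fun p => Module.finrank 𝕜 (LinearMap.range (p : V →ₗ[𝕜] V))) hex
  -- For `p` of minimal rank, a nonzero `p * ρ g * p` would have the same range as `p`, so the
  -- nilpotent `p * ρ g` would map that nonzero range onto itself.
  have hpp : ∀ g, p * ρ g * p = 0 := by
    intro g
    by_contra hne
    have hS := mul_map_mem_degenerateLimits hpS g
    obtain ⟨k, hk⟩ := isNilpotent_of_mem_degenerateLimits hρ hS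
    set r := LinearMap.range (p : V →ₗ[𝕜] V)
    set f : V →ₗ[𝕜] V := ((p * ρ g : V →L[𝕜] V) : V →ₗ[𝕜] V)
    have hle : LinearMap.range ((p * ρ g * p : V →L[𝕜] V) : V →ₗ[𝕜] V) ≤ r := by
      rintro _ ⟨v, rfl⟩
      exact ⟨ρ g (p v), rfl⟩
    have heq := Submodule.eq_of_le_of_finrank_le hle
      (hmin ⟨mul_mem_degenerateLimits hS hpS, hne⟩ (Submodule.finrank_mono hle))
    have hmap : r.map f = r := by
      rw [← LinearMap.range_comp]
      exact heq
    have hmapk : ∀ j : ℕ, r.map (f ^ j) = r := by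
      intro j
      induction j with
      | zero => simp [Module.End.one_eq_id]
      | succ j ih => rw [pow_succ, Module.End.mul_eq_comp, Submodule.map_comp, hmap, ih]
    have := hmapk k
    rw [hk, Submodule.map_zero] at this
    refine hp0 ?_
    ext v
    have : p v ∈ (⊥ : Submodule 𝕜 V) := this ▸ ⟨v, rfl⟩
    simpa using this
  -- The invariant subspace generated by the range of `p` is killed by `p`, hence proper.
  have hWker : Submodule.span 𝕜 {w | ∃ g v, w = ρ g (p v)} ≤ LinearMap.ker (p : V →ₗ[𝕜] V) := by
    rw [Submodule.span_le]
    rintro _ ⟨g, v, rfl⟩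
    exact DFunLike.congr_fun (hpp g) v
  refine ⟨Submodule.span 𝕜 {w | ∃ g v, w = ρ g (p v)}, fun h => hp0 ?_, fun h => hp0 ?_,
    fun g w hw => ?_⟩
  · ext v
    rw [Submodule.span_eq_bot] at h
    exact h _ ⟨1, v, by simp⟩
  · rw [h] at hWker
    ext v
    exact hWker (Submodule.mem_top (x := v))
  · induction hw using Submodule.span_induction with
    | mem x hx =>
      obtain ⟨g', v, rfl⟩ := hx
      exact Submodule.subset_span ⟨g * g', v, by simp⟩
    | zero => simp
    | add x y _ _ hx hy => rw [map_add]; exact add_mem hx hy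
    | smul c x _ hx => rw [map_smul]; exact Submodule.smul_mem _ _ hx

end BoundedRepresentation

/-! ### Stable lattices by induction on dimension -/

section StableLattice

variable {𝕜 : Type*} [NontriviallyNormedField 𝕜]

/-- The representation on `X` obtained by compressing `ρ` along `i : X → V` and `r : V → X`. -/
def compressRepresentation {V X G : Type*} [NormedAddCommGroup V] [NormedSpace 𝕜 V]
    [NormedAddCommGroup X] [NormedSpace 𝕜 X] [Group G] (ρ : G →* (V →L[𝕜] V))
    (i : X →L[𝕜] V) (r : V →L[𝕜] X) (hri : ∀ x, r (i x) = x)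
    (h : ∀ g g' x, r (ρ g (i (r (ρ g' (i x))))) = r (ρ g (ρ g' (i x)))) :
    G →* (X →L[𝕜] X) where
  toFun g := r ∘L ρ g ∘L i
  map_one' := by ext x; simp [hri]
  map_mul' g g' := by ext x; simp [h]

theorem norm_compressRepresentation_le {V X G : Type*} [NormedAddCommGroup V] [NormedSpace 𝕜 V]
    [NormedAddCommGroup X] [NormedSpace 𝕜 X] [Group G] (ρ : G →* (V →L[𝕜] V))
    (i : X →L[𝕜] V) (r : V →L[𝕜] X) (hri : ∀ x, r (i x) = x)
    (h : ∀ g g' x, r (ρ g (i (r (ρ g' (i x))))) = r (ρ g (ρ g' (i x)))) {C : ℝ} {g : G}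
    (hC : ‖ρ g‖ ≤ C) : ‖compressRepresentation ρ i r hri h g‖ ≤ ‖r‖ * (C * ‖i‖) := by
  refine (ContinuousLinearMap.opNorm_comp_le _ _).trans ?_
  gcongr
  refine (ContinuousLinearMap.opNorm_comp_le _ _).trans ?_
  gcongr

theorem isPowerBounded_compressRepresentation {V X G : Type*} [NormedAddCommGroup V]
    [NormedSpace 𝕜 V] [NormedAddCommGroup X] [NormedSpace 𝕜 X] [Group G] (ρ : G →* (V →L[𝕜] V))
    (i : X →L[𝕜] V) (r : V →L[𝕜] X) (hri : ∀ x, r (i x) = x)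
    (h : ∀ g g' x, r (ρ g (i (r (ρ g' (i x))))) = r (ρ g (ρ g' (i x)))) {g : G}
    (hg : IsPowerBounded (ρ g)) : IsPowerBounded (compressRepresentation ρ i r hri h g) := by
  obtain ⟨C, hC⟩ := hg
  refine ⟨‖r‖ * (C * ‖i‖), fun n => ?_⟩
  rw [← map_pow]
  exact norm_compressRepresentation_le _ _ _ _ _ (by rw [map_pow]; exact hC n)

/-- A bounded family of elements acting in a finite-dimensional representation by power bounded
operators has a common stable lattice. -/
theorem exists_isLattice_mapsTo_of_isPowerBounded.{u} [IsUltrametricDist 𝕜] [ProperSpace 𝕜]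
    {V : Type u} [NormedAddCommGroup V] [NormedSpace 𝕜 V] [FiniteDimensional 𝕜 V]
    {G : Type*} [Group G] (ρ : G →* (V →L[𝕜] V)) (hρ : ∀ g, IsPowerBounded (ρ g))
    (S : Set G) (hS : ∃ C : ℝ, ∀ g ∈ S, ‖ρ g‖ ≤ C) :
    ∃ L : AddSubgroup V, IsLattice 𝕜 L ∧ ∀ g ∈ S, ∀ v ∈ L, ρ g v ∈ L := by
  induction hd : Module.finrank 𝕜 V using Nat.strong_induction_on generalizing V with
  | _ d ih =>
  rcases bounded_or_exists_invariant_submodule hρ with hb | ⟨W, hW0, hW1, hW⟩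
  · obtain ⟨L, hL, h⟩ := exists_isLattice_mapsTo_of_bounded ρ hb
    exact ⟨L, hL, fun g _ => h g⟩
  obtain ⟨W', hWW'⟩ := W.exists_isCompl
  let i : W →L[𝕜] V := W.subtypeL
  let i' : W' →L[𝕜] V := W'.subtypeL
  let r : V →L[𝕜] W := (W.projectionOnto W' hWW').toContinuousLinearMap
  let r' : V →L[𝕜] W' := (W'.projectionOnto W hWW'.symm).toContinuousLinearMap
  have hri : ∀ w, r (i w) = w := fun w => W.projectionOnto_apply_left hWW' w
  have hri' : ∀ w, r' (i' w) = w := fun w => W'.projectionOnto_apply_left hWW'.symm w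
  have hr'0 : ∀ g w, r' (ρ g (i w)) = 0 := fun g w =>
    (W'.projectionOnto_apply_eq_zero_iff hWW'.symm).2 (hW g _ w.2)
  have hsum : ∀ v, i (r v) + i' (r' v) = v := fun v =>
    Submodule.projection_add_projection_eq_self hWW' v
  have hir : ∀ g w, i (r (ρ g (i w))) = ρ g (i w) := fun g w =>
    congrArg Subtype.val (hri ⟨_, hW g _ w.2⟩)
  have h1 : ∀ g g' w, r (ρ g (i (r (ρ g' (i w))))) = r (ρ g (ρ g' (i w))) := fun g g' w => by
    rw [hir]
  -- The complement `W'` stands for the quotient `V / W`: since `r'` kills the invariant `W`,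
  -- compression to `W'` is multiplicative.
  have h2 : ∀ g g' w, r' (ρ g (i' (r' (ρ g' (i' w))))) = r' (ρ g (ρ g' (i' w))) := by
    intro g g' w
    conv_rhs => rw [← hsum (ρ g' (i' w)), map_add, map_add, hr'0, zero_add]
  have hdW : Module.finrank 𝕜 W < d := hd ▸ Submodule.finrank_lt hW1
  have hdW' : Module.finrank 𝕜 W' < d := by
    have := Submodule.finrank_add_eq_of_isCompl hWW'
    have := Submodule.one_le_finrank_iff.2 hW0
    omega
  obtain ⟨C, hC⟩ := hS
  obtain ⟨L, hL, hLS⟩ := ih _ hdW (compressRepresentation ρ i r hri h1)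
    (fun g => isPowerBounded_compressRepresentation _ _ _ _ _ (hρ g))
    ⟨_, fun g hg => norm_compressRepresentation_le _ _ _ _ _ (hC g hg)⟩ rfl
  obtain ⟨L', hL', hLS'⟩ := ih _ hdW' (compressRepresentation ρ i' r' hri' h2)
    (fun g => isPowerBounded_compressRepresentation _ _ _ _ _ (hρ g))
    ⟨_, fun g hg => norm_compressRepresentation_le _ _ _ _ _ (hC g hg)⟩ rfl
  obtain ⟨B, hB0, hB⟩ := hL'.exists_norm_le
  -- The diagonal blocks preserve `L` and `L'`. The off-diagonal block `W' → W` is bounded on `S`,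
  -- so shrinking `L'` by a small `t` makes it land in `L`.
  obtain ⟨t, ht, ht0⟩ := (((hL.eventually_smul_mem (‖r‖ * (C * (‖i'‖ * B)))).filter_mono
    nhdsWithin_le_nhds).and (eventually_mem_nhdsWithin (s := {(0 : 𝕜)}ᶜ))).exists
  have hLt := hL'.scale_isLattice ht0
  refine ⟨L.comap r.toLinearMap.toAddMonoidHom ⊓
    (IsLattice.scale L' t).comap r'.toLinearMap.toAddMonoidHom, ⟨?_, ?_, ?_⟩, ?_⟩
  · exact (hL.isOpen.preimage r.continuous).inter (hLt.isOpen.preimage r'.continuous)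
  · obtain ⟨A, hA0, hA⟩ := hL.exists_norm_le
    obtain ⟨A', hA0', hA'⟩ := hLt.exists_norm_le
    refine isBounded_iff_forall_norm_le.2 ⟨‖i‖ * A + ‖i'‖ * A', fun v hv => ?_⟩
    calc ‖v‖ = ‖i (r v) + i' (r' v)‖ := by rw [hsum]
      _ ≤ ‖i (r v)‖ + ‖i' (r' v)‖ := norm_add_le _ _
      _ ≤ _ := add_le_add (i.le_opNorm_of_le (hA _ hv.1)) (i'.le_opNorm_of_le (hA' _ hv.2))
  · intro c v hc hv
    refine ⟨?_, ?_⟩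
    · change r (c • v) ∈ L
      rw [map_smul]
      exact hL.smul_mem c _ hc hv.1
    · change r' (c • v) ∈ IsLattice.scale L' t
      rw [map_smul]
      exact hLt.smul_mem c _ hc hv.2
  · intro g hg v hv
    have hv2 : t⁻¹ • r' v ∈ L' := hv.2
    refine ⟨?_, ?_⟩
    · change r (ρ g v) ∈ L
      rw [← hsum v, map_add, map_add]
      refine add_mem (hLS g hg _ hv.1) ?_
      have : r (ρ g (i' (r' v))) = t • r (ρ g (i' (t⁻¹ • r' v))) := by
        simp only [map_smul, smul_smul, mul_inv_cancel₀ ht0, one_smul]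
      rw [this]
      refine ht _ (r.le_opNorm_of_le ?_)
      exact (ρ g).le_of_opNorm_le_of_le (hC g hg) (i'.le_opNorm_of_le (hB _ hv2))
    · change t⁻¹ • r' (ρ g v) ∈ L'
      rw [← hsum v, map_add, map_add, hr'0, zero_add]
      have := hLS' g hg _ hv2
      rwa [map_smul] at this

end StableLattice

/-! ### Conjugation orbits and recurrence -/

section Conjugation

variable {𝕜 V R : Type*} [NontriviallyNormedField 𝕜] [NormedAddCommGroup V] [NormedSpace 𝕜 V]
  [NormedRing R] [NormedAlgebra 𝕜 R]

/-- The vectors whose forward orbit under `T` is bounded. -/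
def boundedOrbits (T : V →L[𝕜] V) : Submodule 𝕜 V where
  carrier := {v | ∃ C : ℝ, ∀ n : ℕ, ‖(T ^ n) v‖ ≤ C}
  zero_mem' := ⟨0, fun n => by simp⟩
  add_mem' := by
    rintro v w ⟨C, hC⟩ ⟨D, hD⟩
    refine ⟨C + D, fun n => ?_⟩
    rw [map_add]
    exact norm_add_le_of_le (hC n) (hD n)
  smul_mem' := by
    rintro c v ⟨C, hC⟩
    refine ⟨‖c‖ * C, fun n => ?_⟩
    rw [map_smul, norm_smul]
    exact mul_le_mul_of_nonneg_left (hC n) (norm_nonneg _)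

theorem coe_pow_apply_of_coe_apply {T : V →L[𝕜] V} {W : Submodule 𝕜 V} {S : W →L[𝕜] W}
    (h : ∀ w, (S w : V) = T w) (n : ℕ) (w : W) : ((S ^ n) w : V) = (T ^ n) w := by
  induction n generalizing w with
  | zero => simp
  | succ n ih => rw [pow_succ, pow_succ, mul_apply_eq_comp,
      mul_apply_eq_comp, ih, h]

theorem isPowerBounded_of_le_boundedOrbits {T : V →L[𝕜] V} {W : Submodule 𝕜 V} [CompleteSpace W]
    {S : W →L[𝕜] W} (h : ∀ w, (S w : V) = T w) (hW : W ≤ boundedOrbits T) : IsPowerBounded S :=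
  banach_steinhaus fun w => by
    obtain ⟨C, hC⟩ := hW w.2
    exact ⟨C, fun n => by rw [← Submodule.norm_coe, coe_pow_apply_of_coe_apply h]; exact hC n⟩

variable (𝕜 R) in
/-- Conjugation as a representation of the unit group on the algebra. -/
noncomputable def conjRepresentation : Rˣ →* (R →L[𝕜] R) where
  toFun g := ContinuousLinearMap.mulLeftRight 𝕜 R g ↑g⁻¹
  map_one' := by ext; simp
  map_mul' g h := by ext; simp [mul_assoc]

theorem conjRepresentation_apply (g : Rˣ) (v : R) :
    conjRepresentation 𝕜 R g v = g * v * ↑g⁻¹ := rfl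

theorem conjRepresentation_pow_apply (g : Rˣ) (n : ℕ) (v : R) :
    (conjRepresentation 𝕜 R g ^ n) v = ↑(g ^ n) * v * ↑(g ^ n)⁻¹ := by
  rw [← map_pow, conjRepresentation_apply]

theorem conjRepresentation_pow_one (g : Rˣ) (n : ℕ) : (conjRepresentation 𝕜 R g ^ n) 1 = 1 := by
  rw [conjRepresentation_pow_apply, mul_one, Units.mul_inv]

theorem conjRepresentation_pow_mul (g : Rˣ) (n : ℕ) (v w : R) :
    (conjRepresentation 𝕜 R g ^ n) (v * w) =
      (conjRepresentation 𝕜 R g ^ n) v * (conjRepresentation 𝕜 R g ^ n) w := by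
  simp only [conjRepresentation_pow_apply, mul_assoc, Units.inv_mul_cancel_left]

theorem one_mem_boundedOrbits (g : Rˣ) : (1 : R) ∈ boundedOrbits (conjRepresentation 𝕜 R g) :=
  ⟨‖(1 : R)‖, fun n => by rw [conjRepresentation_pow_one]⟩

theorem mul_mem_boundedOrbits {g : Rˣ} {v w : R}
    (hv : v ∈ boundedOrbits (conjRepresentation 𝕜 R g))
    (hw : w ∈ boundedOrbits (conjRepresentation 𝕜 R g)) :
    v * w ∈ boundedOrbits (conjRepresentation 𝕜 R g) := by
  obtain ⟨C, hC⟩ := hv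
  obtain ⟨D, hD⟩ := hw
  refine ⟨C * D, fun n => ?_⟩
  rw [conjRepresentation_pow_mul]
  exact norm_mul_le_of_le (hC n) (hD n)

/-- The vectors with bounded orbit form a finite-dimensional subalgebra; left multiplication by `x`
is injective on it, hence surjective, and so reaches `1`. -/
theorem inv_mem_boundedOrbits [FiniteDimensional 𝕜 R] {g x : Rˣ}
    (hx : (x : R) ∈ boundedOrbits (conjRepresentation 𝕜 R g)) :
    ((x⁻¹ : Rˣ) : R) ∈ boundedOrbits (conjRepresentation 𝕜 R g) := by
  let f : boundedOrbits (conjRepresentation 𝕜 R g) →ₗ[𝕜] boundedOrbits (conjRepresentation 𝕜 R g) :=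
    (LinearMap.mulLeft 𝕜 (x : R)).restrict fun v hv => mul_mem_boundedOrbits hx hv
  have hf : Function.Injective f := fun v w h => Subtype.ext (by
    have : (x : R) * v = x * w := congrArg Subtype.val h
    simpa using this)
  obtain ⟨y, hy⟩ := LinearMap.injective_iff_surjective.1 hf ⟨1, one_mem_boundedOrbits g⟩
  have : (x : R) * y = 1 := congrArg Subtype.val hy
  have h : ((x⁻¹ : Rˣ) : R) = y := by rw [← mul_one ((x⁻¹ : Rˣ) : R), ← this, Units.inv_mul_cancel_left]
  rw [h]
  exact y.2

/-- For a power bounded operator there is an idempotent in the closure of its positive powers. -/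
theorem IsPowerBounded.exists_idempotent [ProperSpace 𝕜] [FiniteDimensional 𝕜 V] {T : V →L[𝕜] V}
    (hT : IsPowerBounded T) : ∃ e ∈ closure {S | ∃ n ≥ 1, S = T ^ n}, e * e = e := by
  obtain ⟨C, hC⟩ := hT
  have : ProperSpace (V →L[𝕜] V) := FiniteDimensional.proper 𝕜 _
  -- The closure of the positive powers is a compact semigroup, so the Ellis–Numakura lemma applies.
  refine exists_idempotent_in_compact_subsemigroup (fun r => by fun_prop) _
    ⟨T, subset_closure ⟨1, le_rfl, by simp⟩⟩ ?_ fun a ha b hb =>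
      map_mem_closure₂ continuous_mul ha hb ?_
  · refine Metric.isCompact_of_isClosed_isBounded isClosed_closure (Bornology.IsBounded.closure ?_)
    refine isBounded_iff_forall_norm_le.2 ⟨C, ?_⟩
    rintro _ ⟨n, -, rfl⟩
    exact hC n
  · rintro _ ⟨m, hm, rfl⟩ _ ⟨n, hn, rfl⟩
    exact ⟨m + n, by omega, (pow_add _ _ _).symm⟩

/-- Some `T ^ m` is close to `e`, so `(T ^ m) v` is small, and the uniform bound keeps all later
iterates small. -/
theorem IsPowerBounded.tendsto_pow_apply_zero {T e : V →L[𝕜] V} (hT : IsPowerBounded T)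
    (he : e ∈ closure {S | ∃ n ≥ 1, S = T ^ n}) {v : V} (hv : e v = 0) :
    Tendsto (fun n : ℕ => (T ^ n) v) atTop (𝓝 0) := by
  obtain ⟨C, hC⟩ := hT
  have hC0 : 0 ≤ C := (norm_nonneg _).trans (hC 0)
  rw [Metric.tendsto_atTop]
  intro ε hε
  obtain ⟨_, ⟨m, -, rfl⟩, hm⟩ := Metric.mem_closure_iff.1 he (ε / ((C + 1) * (‖v‖ + 1)))
    (by positivity)
  refine ⟨m, fun n hn => ?_⟩
  obtain ⟨k, rfl⟩ := Nat.exists_eq_add_of_le' hn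
  rw [dist_zero_right, pow_add, mul_apply_eq_comp]
  have h1 : ‖(T ^ m) v‖ ≤ ε / ((C + 1) * (‖v‖ + 1)) * ‖v‖ := by
    have : (T ^ m) v = -((e - T ^ m) v) := by simp [hv]
    rw [this, norm_neg]
    exact ContinuousLinearMap.le_of_opNorm_le _ (by rw [← dist_eq_norm]; exact hm.le) _
  calc ‖(T ^ k) ((T ^ m) v)‖ ≤ C * (ε / ((C + 1) * (‖v‖ + 1)) * ‖v‖) :=
        ContinuousLinearMap.le_of_opNorm_le_of_le _ (hC k) h1
    _ = ε * ((C / (C + 1)) * (‖v‖ / (‖v‖ + 1))) := by field_simp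
    _ < ε * 1 := by
        gcongr
        have h2 : C / (C + 1) < 1 := (div_lt_one (by positivity)).2 (by linarith)
        have h3 : ‖v‖ / (‖v‖ + 1) < 1 := (div_lt_one (by positivity)).2 (by linarith)
        have h4 : 0 ≤ C / (C + 1) := by positivity
        have h5 : 0 ≤ ‖v‖ / (‖v‖ + 1) := by positivity
        nlinarith
    _ = ε := mul_one ε

variable {G : Subgroup Rˣ}

/-- The units carry the topology induced from `R`, so being closed in the units lets `G` capture
limits taken in `R`, provided the limit is a unit. -/
theorem mem_of_val_mem_closure [CompleteSpace R] (hG : IsClosed (G : Set Rˣ)) {x : Rˣ} {s : Set R}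
    (hs : ∀ y ∈ s, ∃ g ∈ G, (g : R) = y) (hx : (x : R) ∈ closure s) : x ∈ G := by
  rw [← SetLike.mem_coe, ← hG.closure_eq,
    Units.isOpenEmbedding_val.isEmbedding.closure_eq_preimage_closure_image]
  exact closure_mono hs hx

/-- If the contraction subgroup of `g` is trivial, then the elements with bounded forward orbit
under conjugation by `g` are recurrent. -/
theorem mem_closure_orbit_of_mem_boundedOrbits [ProperSpace 𝕜] [FiniteDimensional 𝕜 R]
    (hG : IsClosed (G : Set Rˣ)) {g x : G}
    (hg : contractionSubgroup g = ⊥)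
    (hx : ((x : Rˣ) : R) ∈ boundedOrbits (conjRepresentation 𝕜 R g)) :
    ((x : Rˣ) : R) ∈ closure {y | ∃ n ≥ 1, y = (conjRepresentation 𝕜 R g ^ n) (x : Rˣ)} := by
  have : CompleteSpace R := FiniteDimensional.complete 𝕜 R
  set T := conjRepresentation 𝕜 R g
  let P := boundedOrbits T
  have : CompleteSpace P := FiniteDimensional.complete 𝕜 P
  have hPinv : ∀ v : P, T v ∈ P := fun v => by
    obtain ⟨C, hC⟩ := v.2
    refine ⟨C, fun n => ?_⟩
    rw [← mul_apply_eq_comp, ← pow_succ]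
    exact hC _
  let S : P →L[𝕜] P := (T ∘L P.subtypeL).codRestrict P hPinv
  have hST : ∀ w, (S w : R) = T w := fun w => rfl
  have hSn := coe_pow_apply_of_coe_apply hST
  have hS : IsPowerBounded S := isPowerBounded_of_le_boundedOrbits hST le_rfl
  obtain ⟨e, he, hee⟩ := hS.exists_idempotent
  let a : P := ⟨(x : Rˣ), hx⟩
  let b : P := ⟨((x⁻¹ : Rˣ) : R), inv_mem_boundedOrbits hx⟩
  have hev : ∀ w : P, Continuous fun f : P →L[𝕜] P => (f w : R) := fun w =>
    continuous_subtype_val.comp (by fun_prop)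
  -- As a limit of algebra automorphisms, `e` preserves the relation `v * w = 1`; hence `e a` is a
  -- unit with inverse `e b`.
  have hmul : ∀ v w : P, (v : R) * w = 1 → (e v : R) * e w = 1 := by
    intro v w hvw
    have := map_mem_closure (t := {(1 : R)}) ((hev v).mul (hev w)) he ?_
    · rwa [isClosed_singleton.closure_eq] at this
    · rintro _ ⟨n, -, rfl⟩
      change ((S ^ n) v : R) * (S ^ n) w = 1
      rw [hSn, hSn, ← conjRepresentation_pow_mul, hvw, conjRepresentation_pow_one]
  let x₀ : Rˣ := ⟨e a, e b, hmul a b (by simp [a, b]), hmul b a (by simp [a, b])⟩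
  have hx₀ : (e a : R) ∈ closure {y | ∃ n ≥ 1, y = (T ^ n) (x : Rˣ)} := by
    refine map_mem_closure (f := fun f : P →L[𝕜] P => (f a : R)) (hev a) he ?_
    rintro _ ⟨n, hn, rfl⟩
    exact ⟨n, hn, hSn n a⟩
  have hx₀G : x₀ ∈ G := by
    refine mem_of_val_mem_closure hG ?_ hx₀
    rintro _ ⟨n, -, rfl⟩
    refine ⟨g ^ n * x * (g ^ n)⁻¹, (g ^ n * x * (g ^ n)⁻¹ : G).2, ?_⟩
    rw [conjRepresentation_pow_apply, Units.val_mul, Units.val_mul]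
    rfl
  -- Here `z = 1 + e b * (a - e a)`. Iteration sends `a - e a`, killed by `e`, to `0` while `e b`
  -- stays bounded, so `z` is contracted to `1`.
  let z : G := ⟨x₀, hx₀G⟩⁻¹ * x
  have hz : z ∈ contractionSubgroup g := by
    change Tendsto (fun n : ℕ => g ^ n * z * (g ^ n)⁻¹) atTop (𝓝 1)
    rw [tendsto_subtype_rng, Units.isOpenEmbedding_val.isEmbedding.tendsto_nhds_iff]
    have hlim : Tendsto (fun n : ℕ => ((S ^ n) (a - e a) : R)) atTop (𝓝 0) := by
      have := hS.tendsto_pow_apply_zero he (v := a - e a) (by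
        rw [map_sub, ← mul_apply_eq_comp, hee, sub_self])
      exact (continuous_subtype_val.tendsto 0).comp this
    obtain ⟨C, hC⟩ := (e b).2
    have hlim2 : Tendsto (fun n : ℕ => (T ^ n) (e b : R) * ((S ^ n) (a - e a) : R)) atTop (𝓝 0) :=
      squeeze_zero_norm (fun n => norm_mul_le_of_le (hC n) le_rfl) (by
        simpa using hlim.norm.const_mul C)
    have hz1 : ((z : Rˣ) : R) = e b * (a - e a) + 1 := by
      have h1 : (e b : R) * e a = 1 := x₀.inv_mul
      rw [mul_sub, h1, sub_add_cancel]
      rfl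
    have heq : ∀ n : ℕ, (((g ^ n * z * (g ^ n)⁻¹ : G) : Rˣ) : R) =
        (T ^ n) (e b : R) * ((S ^ n) (a - e a) : R) + 1 := by
      intro n
      have : (((g ^ n * z * (g ^ n)⁻¹ : G) : Rˣ) : R) = (T ^ n) ((z : Rˣ) : R) := by
        rw [conjRepresentation_pow_apply]
        simp
      rw [this, hz1, map_add, conjRepresentation_pow_one, conjRepresentation_pow_mul, hSn]
      rfl
    have := hlim2.add_const 1
    rw [zero_add] at this
    exact this.congr fun n => (heq n).symm
  rw [hg, Subgroup.mem_bot] at hz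
  have hxx₀ : x = ⟨x₀, hx₀G⟩ := (inv_mul_eq_one.1 hz).symm
  have : ((x : Rˣ) : R) = e a := congrArg (fun y : G => ((y : Rˣ) : R)) hxx₀
  rw [← this] at hx₀
  exact hx₀

end Conjugation

/-! ### Bounded orbits near the identity -/

section BoundedOrbits

variable {𝕜 R : Type*} [NontriviallyNormedField 𝕜] [NormedRing R] [NormedAlgebra 𝕜 R]
  {G : Subgroup Rˣ}

theorem exists_isLattice_norm_le (𝕜 V : Type*) [NontriviallyNormedField 𝕜] [IsUltrametricDist 𝕜]
    [CompleteSpace 𝕜] [NormedAddCommGroup V] [NormedSpace 𝕜 V] [FiniteDimensional 𝕜 V] {ε : ℝ}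
    (hε : 0 < ε) : ∃ L : AddSubgroup V, IsLattice 𝕜 L ∧ ∀ v ∈ L, ‖v‖ ≤ ε := by
  obtain ⟨L, hL⟩ := exists_isLattice 𝕜 V
  obtain ⟨C, hC0, hC⟩ := hL.exists_norm_le
  obtain ⟨t, ht0, ht⟩ := NormedField.exists_norm_lt 𝕜 (div_pos hε hC0)
  have ht1 : t ≠ 0 := norm_pos_iff.1 ht0
  refine ⟨IsLattice.scale L t, hL.scale_isLattice ht1, fun v hv => ?_⟩
  have := hC _ hv
  change ‖t⁻¹ • v‖ ≤ C at this
  rw [norm_smul, norm_inv, inv_mul_le_iff₀ ht0] at this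
  rw [lt_div_iff₀ hC0] at ht
  exact this.trans ht.le

theorem isUnit_of_norm_sub_one_lt_one [CompleteSpace R] {y : R} (hy : ‖y - 1‖ < 1) : IsUnit y := by
  rw [← sub_sub_cancel 1 y]
  exact isUnit_one_sub_of_norm_lt_one (by rwa [norm_sub_rev])

/-- If all contraction subgroups are trivial, then all elements near the identity have bounded
forward orbit under conjugation by a given element. -/
theorem eventually_mem_boundedOrbits [IsUltrametricDist 𝕜] [ProperSpace 𝕜] [FiniteDimensional 𝕜 R]
    (hG : IsClosed (G : Set Rˣ)) (hcontr : ∀ g : G, contractionSubgroup g = ⊥) (g : G) :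
    ∀ᶠ x : G in 𝓝 1, ((x : Rˣ) : R) ∈ boundedOrbits (conjRepresentation 𝕜 R g) := by
  have : CompleteSpace R := FiniteDimensional.complete 𝕜 R
  have : ProperSpace R := FiniteDimensional.proper 𝕜 R
  set T := conjRepresentation 𝕜 R g with hTdef
  have hval : Continuous fun x : G => ((x : Rˣ) : R) :=
    Units.continuous_val.comp continuous_subtype_val
  have hT1 : ∀ n : ℕ, (T ^ n) 1 = 1 := conjRepresentation_pow_one _
  -- The radius ensures that one application of `T` to `L` stays in the ball of radius `1/2`, so
  -- points at first exit, and their limits, are units.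
  obtain ⟨L, hL, hLT⟩ := exists_isLattice_norm_le 𝕜 R (ε := (2 * (‖T‖ + 1))⁻¹) (by positivity)
  by_contra hne
  have hfreq : ∃ᶠ x : G in 𝓝 1, ∃ n : ℕ, (T ^ n) ((x : Rˣ) - 1 : R) ∉ L := by
    refine (not_eventually.1 hne).mono fun x hx => ?_
    by_contra! hall
    refine hx ?_
    obtain ⟨C, -, hC⟩ := hL.exists_norm_le
    rw [← sub_add_cancel ((x : Rˣ) : R) 1]
    exact add_mem ⟨C, fun n => hC _ (hall n)⟩ (one_mem_boundedOrbits _)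
  have : (𝓝 (1 : G)).IsCountablyGenerated := by
    rw [(Units.isOpenEmbedding_val.isInducing.comp IsInducing.subtypeVal).nhds_eq_comap]
    infer_instance
  obtain ⟨x, hx1, hx⟩ := exists_seq_forall_of_frequently hfreq
  classical
  let N : ℕ → ℕ := fun k => Nat.find (hx k)
  have hN : ∀ k, (T ^ N k) ((x k : Rˣ) - 1 : R) ∉ L := fun k => Nat.find_spec (hx k)
  have hNlt : ∀ k j, j < N k → (T ^ j) ((x k : Rˣ) - 1 : R) ∈ L := fun k j hj =>
    not_not.1 (Nat.find_min (hx k) hj)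
  -- Each fixed iterate is continuous and fixes `1`, so the first exit times tend to infinity.
  have hNtop : Tendsto N atTop atTop := by
    refine tendsto_atTop.2 fun m => ?_
    have : ∀ j ∈ Finset.range m, ∀ᶠ k in atTop, (T ^ j) ((x k : Rˣ) - 1 : R) ∈ L := by
      intro j _
      have hc : Continuous fun y : G => (T ^ j) ((y : Rˣ) - 1 : R) := by fun_prop
      refine (hc.tendsto 1).comp hx1 (hL.isOpen.mem_nhds ?_)
      simp
    filter_upwards [(Filter.eventually_all_finset _).2 this] with k hk
    by_contra! hlt
    exact hN k (hk _ (Finset.mem_range.2 hlt))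
  let y : ℕ → R := fun k => (T ^ N k) ((x k : Rˣ) : R)
  have hy1 : ∀ k, y k - 1 = (T ^ N k) ((x k : Rˣ) - 1 : R) := fun k => by
    rw [map_sub, hT1]
  have hyball : ∀ᶠ k in atTop, y k ∈ Metric.closedBall (1 : R) 2⁻¹ := by
    filter_upwards [hNtop.eventually_ge_atTop 1] with k hk
    rw [mem_closedBall_iff_norm, hy1]
    obtain ⟨n, hn⟩ := Nat.exists_eq_add_of_le' hk
    rw [hn, pow_succ', mul_apply_eq_comp]
    calc _ ≤ ‖T‖ * (2 * (‖T‖ + 1))⁻¹ := T.le_opNorm_of_le (hLT _ (hNlt k n (by omega)))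
      _ ≤ (‖T‖ + 1) * (2 * (‖T‖ + 1))⁻¹ := by gcongr; linarith
      _ = 2⁻¹ := by field_simp
  obtain ⟨w, hw, φ, hφ, hlim⟩ := (isCompact_closedBall (1 : R) 2⁻¹).tendsto_subseq'
    hyball.frequently
  obtain ⟨u, rfl⟩ := isUnit_of_norm_sub_one_lt_one (y := w)
    ((mem_closedBall_iff_norm.1 hw).trans_lt (by norm_num))
  have huG : u ∈ G := by
    refine mem_of_val_mem_closure hG (s := Set.range y) ?_
      (mem_closure_of_tendsto hlim (Eventually.of_forall fun k => ⟨_, rfl⟩))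
    rintro _ ⟨k, rfl⟩
    refine ⟨g ^ N k * x k * (g ^ N k)⁻¹, (g ^ N k * x k * (g ^ N k)⁻¹ : G).2, ?_⟩
    simp only [y]
    rw [conjRepresentation_pow_apply, Units.val_mul, Units.val_mul]
    rfl
  have huL : (u : R) - 1 ∉ L := by
    refine hL.isOpen.isClosed_compl.mem_of_tendsto (hlim.sub_const 1) (Eventually.of_forall ?_)
    intro k
    change y (φ k) - 1 ∉ L
    rw [hy1]
    exact hN _
  set T' := conjRepresentation 𝕜 R ((g⁻¹ : G) : Rˣ) with hT'def
  have hT'T : T' * T = 1 := by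
    rw [hT'def, hTdef, ← map_mul, ← Subgroup.coe_mul, inv_mul_cancel, Subgroup.coe_one, map_one]
  have hT'1 : ∀ n : ℕ, (T' ^ n) 1 = 1 := conjRepresentation_pow_one _
  have hT'Tn : ∀ m n : ℕ, m ≤ n → ∀ v, (T' ^ m) ((T ^ n) v) = (T ^ (n - m)) v := by
    intro m n hmn v
    obtain ⟨j, rfl⟩ := Nat.exists_eq_add_of_le hmn
    rw [pow_add, ← mul_apply_eq_comp, ← mul_assoc, pow_mul_pow_eq_one m hT'T, one_mul,
      Nat.add_sub_cancel_left]
  -- Going back `m ≥ 1` steps from the first exit lands at an earlier time, still in `L`; at `m = 0`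
  -- this fails.
  have hback : ∀ m ≥ 1, (T' ^ m) ((u : R) - 1) ∈ L := by
    intro m hm
    have h1 : Tendsto (fun k => (T' ^ m) (y (φ k) - 1)) atTop (𝓝 ((T' ^ m) ((u : R) - 1))) :=
      ((T' ^ m).continuous.tendsto _).comp (hlim.sub_const 1)
    refine hL.isClosed.mem_of_tendsto h1 ?_
    filter_upwards [hφ.tendsto_atTop.eventually (hNtop.eventually_ge_atTop m)] with k hk
    rw [hy1, hT'Tn _ _ hk]
    exact hNlt _ _ (by omega)
  obtain ⟨C, -, hC⟩ := hL.exists_norm_le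
  have hub : (u : R) ∈ boundedOrbits T' := by
    rw [← sub_add_cancel (u : R) 1]
    refine add_mem ⟨max C ‖(u : R) - 1‖, fun n => ?_⟩ (one_mem_boundedOrbits _)
    rcases Nat.eq_zero_or_pos n with rfl | hn
    · simp
    · exact (hC _ (hback n hn)).trans (le_max_left _ _)
  -- Recurrence along strictly positive times puts `u - 1` in the closed set `L`, contradicting
  -- `huL`.
  have hrec := mem_closure_orbit_of_mem_boundedOrbits (x := (⟨u, huG⟩ : G)) hG (hcontr g⁻¹) hub
  refine huL ?_
  have := map_mem_closure (f := fun v : R => v - 1) (t := (L : Set R)) (by fun_prop) hrec ?_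
  · rwa [hL.isClosed.closure_eq] at this
  · rintro _ ⟨n, hn, rfl⟩
    have := hback n hn
    rwa [map_sub, hT'1] at this

end BoundedOrbits

/-! ### From a stable lattice to compact open normal subgroups -/

section CompactOpenNormal

variable {𝕜 R : Type*} [NontriviallyNormedField 𝕜] [NormedRing R] [NormedAlgebra 𝕜 R]

variable (𝕜) in
/-- The span of the differences `x - 1`, for `x` in a set of units. -/
def spanSubOne {G : Subgroup Rˣ} (U : Set G) : Submodule 𝕜 R :=
  Submodule.span 𝕜 ((fun x : G => ((x : Rˣ) : R) - 1) '' U)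

variable {G : Subgroup Rˣ}

theorem sub_one_mem_spanSubOne {U : Set G} {x : G} (hx : x ∈ U) :
    ((x : Rˣ) : R) - 1 ∈ spanSubOne 𝕜 U := Submodule.subset_span ⟨x, hx, rfl⟩

theorem spanSubOne_le {U : Set G} {W : Submodule 𝕜 R}
    (h : ∀ x ∈ U, ((x : Rˣ) : R) - 1 ∈ W) : spanSubOne 𝕜 U ≤ W := by
  rw [spanSubOne, Submodule.span_le]
  rintro _ ⟨x, hx, rfl⟩
  exact h x hx

theorem spanSubOne_mono {U U' : Set G} (h : U ⊆ U') : spanSubOne 𝕜 U ≤ spanSubOne 𝕜 U' :=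
  spanSubOne_le fun _ hx => sub_one_mem_spanSubOne (h hx)

-- Choose `U` with span of least dimension; intersecting with `U'` cannot shrink it. The span thus
-- depends only on the germ of `G` at `1`.
variable (𝕜 G) in
theorem exists_nhds_spanSubOne_le [FiniteDimensional 𝕜 R] :
    ∃ U ∈ 𝓝 (1 : G), ∀ U' ∈ 𝓝 (1 : G), spanSubOne 𝕜 U ≤ spanSubOne 𝕜 U' := by
  obtain ⟨U, hU, hmin⟩ := exists_minimalFor_of_wellFoundedLT (fun U : Set G => U ∈ 𝓝 1)
    (fun U => Module.finrank 𝕜 (spanSubOne 𝕜 U)) ⟨_, univ_mem⟩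
  refine ⟨U, hU, fun U' hU' => ?_⟩
  have hle : spanSubOne 𝕜 (U ∩ U') ≤ spanSubOne 𝕜 U := spanSubOne_mono Set.inter_subset_left
  have := Submodule.eq_of_le_of_finrank_le hle
    (hmin (inter_mem hU hU') (Submodule.finrank_mono hle))
  rw [← this]
  exact spanSubOne_mono Set.inter_subset_right

/-- By minimality `x` may be restricted to a neighbourhood that conjugation by `g` sends into `U`.
-/
theorem conjRepresentation_mem_spanSubOne {U : Set G} (hU : U ∈ 𝓝 1)
    (hmin : ∀ U' ∈ 𝓝 (1 : G), spanSubOne 𝕜 U ≤ spanSubOne 𝕜 U') (g : G) {v : R}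
    (hv : v ∈ spanSubOne 𝕜 U) : conjRepresentation 𝕜 R g v ∈ spanSubOne 𝕜 U := by
  have hc : Continuous fun x : G => g * x * g⁻¹ := by fun_prop
  have hU' : {x : G | g * x * g⁻¹ ∈ U} ∈ 𝓝 1 :=
    hc.continuousAt.preimage_mem_nhds (by simpa using hU)
  have hle : spanSubOne 𝕜 {x : G | g * x * g⁻¹ ∈ U} ≤
      (spanSubOne 𝕜 U).comap (conjRepresentation 𝕜 R g).toLinearMap := by
    refine spanSubOne_le fun x hx => ?_
    have := sub_one_mem_spanSubOne (𝕜 := 𝕜) (x := g * x * g⁻¹) hx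
    change conjRepresentation 𝕜 R g _ ∈ spanSubOne 𝕜 U
    rwa [map_sub, conjRepresentation_apply, conjRepresentation_apply, mul_one, Units.mul_inv]
  exact hle (hmin _ hU' hv)

/-- `(x - 1) * (y - 1) = (x * y - 1) - (x - 1) - (y - 1)`, with `x`, `y` in a neighbourhood whose
products lie in `U`. -/
theorem mul_mem_spanSubOne {U : Set G} (hU : U ∈ 𝓝 1)
    (hmin : ∀ U' ∈ 𝓝 (1 : G), spanSubOne 𝕜 U ≤ spanSubOne 𝕜 U') {v w : R}
    (hv : v ∈ spanSubOne 𝕜 U) (hw : w ∈ spanSubOne 𝕜 U) : v * w ∈ spanSubOne 𝕜 U := by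
  obtain ⟨U', hU', hmul⟩ := exists_nhds_one_split hU
  have hle : spanSubOne 𝕜 U' * spanSubOne 𝕜 U' ≤ spanSubOne 𝕜 U := by
    rw [spanSubOne, Submodule.span_mul_span, Submodule.span_le]
    rintro _ ⟨_, ⟨x, hx, rfl⟩, _, ⟨y, hy, rfl⟩, rfl⟩
    have h1 : (1 : G) ∈ U' := mem_of_mem_nhds hU'
    have hx' := sub_one_mem_spanSubOne (𝕜 := 𝕜) (hmul x hx 1 h1)
    have hy' := sub_one_mem_spanSubOne (𝕜 := 𝕜) (hmul 1 h1 y hy)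
    have hxy := sub_one_mem_spanSubOne (𝕜 := 𝕜) (hmul x hx y hy)
    rw [mul_one] at hx'
    rw [one_mul] at hy'
    have heq : (((x : Rˣ) : R) - 1) * (((y : Rˣ) : R) - 1) =
        (((x * y : G) : Rˣ) : R) - 1 - ((x : Rˣ) - 1) - ((y : Rˣ) - 1) := by
      rw [Subgroup.coe_mul, Units.val_mul]
      noncomm_ring
    have := sub_mem (sub_mem hxy hx') hy'
    rwa [← heq] at this
  exact hle (Submodule.mul_mem_mul (hmin _ hU' hv) (hmin _ hU' hw))

theorem continuous_conjRepresentation [CompleteSpace R] :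
    Continuous fun g : Rˣ => conjRepresentation 𝕜 R g := by
  change Continuous fun g : Rˣ => ContinuousLinearMap.mulLeftRight 𝕜 R (g : R) ((g⁻¹ : Rˣ) : R)
  have h : Continuous fun g : Rˣ => ((g⁻¹ : Rˣ) : R) := Units.continuous_val.comp continuous_inv
  fun_prop

/-- A compactly generated group with trivial contraction subgroups stabilizes a lattice in the
span of the differences `x - 1`, for `x` in a small neighbourhood of the identity. -/
theorem exists_isLattice_conjRepresentation_mem [IsUltrametricDist 𝕜] [ProperSpace 𝕜]
    [FiniteDimensional 𝕜 R] (hG : IsClosed (G : Set Rˣ)) (hgen : IsCompactlyGeneratedGroup G)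
    (hcontr : ∀ g : G, contractionSubgroup g = ⊥) {U : Set G} (hU : U ∈ 𝓝 1)
    (hmin : ∀ U' ∈ 𝓝 (1 : G), spanSubOne 𝕜 U ≤ spanSubOne 𝕜 U') :
    ∃ L : AddSubgroup (spanSubOne 𝕜 U), IsLattice 𝕜 L ∧ ∀ (g : G), ∀ v ∈ L, ∀ w : spanSubOne 𝕜 U,
      (w : R) = conjRepresentation 𝕜 R g v → w ∈ L := by
  have : CompleteSpace R := FiniteDimensional.complete 𝕜 R
  set V := spanSubOne 𝕜 U with hV
  have : CompleteSpace V := FiniteDimensional.complete 𝕜 V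
  have hinv : ∀ (g : G), ∀ v ∈ V, conjRepresentation 𝕜 R g v ∈ V := fun g v hv =>
    conjRepresentation_mem_spanSubOne hU hmin g hv
  obtain ⟨W, hVW⟩ := V.exists_isCompl
  let r : R →L[𝕜] V := (V.projectionOnto W hVW).toContinuousLinearMap
  have hr : ∀ v : V, r v = v := fun v => V.projectionOnto_apply_left hVW v
  have hr' : ∀ v ∈ V, (r v : R) = v := fun v hv => congrArg Subtype.val (hr ⟨v, hv⟩)
  let σ : G →* (R →L[𝕜] R) := (conjRepresentation 𝕜 R).comp G.subtype
  let ρ : G →* (V →L[𝕜] V) := compressRepresentation σ V.subtypeL r hr fun g g' v => by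
    congr 2
    exact hr' _ (hinv g' _ v.2)
  have hρ : ∀ g v, (ρ g v : R) = conjRepresentation 𝕜 R g v := fun g v => hr' _ (hinv g _ v.2)
  -- The neighbourhood with bounded orbits depends on `g`, but by minimality `V` lies in its span
  -- for every `g`.
  have hpow : ∀ g, IsPowerBounded (ρ g) := fun g =>
    isPowerBounded_of_le_boundedOrbits (hρ g) <|
      (hmin _ (eventually_mem_boundedOrbits (𝕜 := 𝕜) hG hcontr g)).trans <|
        spanSubOne_le fun x hx => sub_mem hx (one_mem_boundedOrbits _)
  obtain ⟨S, hS, hSgen⟩ := hgen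
  have hσ : Continuous σ := continuous_conjRepresentation.comp continuous_subtype_val
  obtain ⟨C, hC⟩ := ((hS.union hS.inv).image hσ).isBounded.exists_norm_le
  -- Inverses are included because stability of `L` under `ρ g` does not by itself give stability
  -- under `ρ g⁻¹`.
  obtain ⟨L, hL, hLS⟩ := exists_isLattice_mapsTo_of_isPowerBounded ρ hpow (S ∪ S⁻¹)
    ⟨_, fun g hg => norm_compressRepresentation_le _ _ _ _ _ (hC _ ⟨g, hg, rfl⟩)⟩
  have hall : ∀ g : G, ∀ v ∈ L, ρ g v ∈ L := by
    intro g
    have hg : g ∈ Subgroup.closure S := hSgen ▸ Subgroup.mem_top g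
    rw [← Subgroup.mem_toSubmonoid, Subgroup.closure_toSubmonoid] at hg
    induction hg using Submonoid.closure_induction with
    | mem x hx => exact hLS x hx
    | one => simp
    | mul x y _ _ hx hy =>
      intro v hv
      rw [map_mul, mul_apply_eq_comp]
      exact hx _ (hy _ hv)
  refine ⟨L, hL, fun g v hv w hw => ?_⟩
  rw [← hρ] at hw
  rw [Subtype.ext hw]
  exact hall g v hv

/-- A lattice stable under conjugation, in a subalgebra containing `x - 1` for all `x` near the
identity, gives rise to small compact open normal subgroups. -/
theorem exists_normal_isOpen_isCompact_subset [IsUltrametricDist 𝕜] [ProperSpace 𝕜]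
    [FiniteDimensional 𝕜 R] (hG : IsClosed (G : Set Rˣ)) {V : Submodule 𝕜 R}
    (hU : ∀ᶠ x : G in 𝓝 1, ((x : Rˣ) : R) - 1 ∈ V) (hmul : ∀ v ∈ V, ∀ w ∈ V, v * w ∈ V)
    (hconj : ∀ (g : G), ∀ v ∈ V, conjRepresentation 𝕜 R g v ∈ V)
    {L : AddSubgroup V} (hL : IsLattice 𝕜 L)
    (hLconj : ∀ (g : G), ∀ v ∈ L, ∀ w : V,
      (w : R) = conjRepresentation 𝕜 R g v → w ∈ L) {O : Set G} (hO : O ∈ 𝓝 1) :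
    ∃ K : Subgroup G, (K.Normal ∧ IsOpen (K : Set G) ∧ IsCompact (K : Set G)) ∧ (K : Set G) ⊆ O := by
  have : CompleteSpace R := FiniteDimensional.complete 𝕜 R
  have : ProperSpace R := FiniteDimensional.proper 𝕜 R
  have hind : IsInducing fun x : G => ((x : Rˣ) : R) :=
    Units.isOpenEmbedding_val.isInducing.comp IsInducing.subtypeVal
  obtain ⟨ε, hε, hεO⟩ : ∃ ε > 0, ∀ x : G, ‖((x : Rˣ) : R) - 1‖ < ε → x ∈ O := by
    rw [hind.nhds_eq_comap, mem_comap] at hO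
    obtain ⟨O', hO', hsub⟩ := hO
    obtain ⟨ε, hε, hb⟩ := Metric.mem_nhds_iff.1 hO'
    exact ⟨ε, hε, fun x hx => hsub (hb (by simpa [dist_eq_norm] using hx))⟩
  obtain ⟨δ, hδ, hLδ⟩ := hL.exists_ball_subset
  obtain ⟨C, hC, hLC⟩ := hL.exists_norm_le
  -- The three bounds make `t • L` closed under multiplication, place `K` inside `O`, and keep `1 +
  -- t • L` within `1/2` of `1`, where all elements are units.
  obtain ⟨t, ht0, ht⟩ := NormedField.exists_norm_lt 𝕜
    (show 0 < min (δ / C ^ 2) (min (ε / C) (2⁻¹ / C)) by positivity)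
  rw [lt_min_iff, lt_min_iff, lt_div_iff₀ (by positivity), lt_div_iff₀ hC, lt_div_iff₀ hC] at ht
  obtain ⟨ht1, ht2, ht3⟩ := ht
  have htne : t ≠ 0 := norm_pos_iff.1 ht0
  set M := IsLattice.scale L t with hM
  have hMmem : ∀ v : V, v ∈ M ↔ t⁻¹ • v ∈ L := fun v => Iff.rfl
  have hMlat : IsLattice 𝕜 M := hL.scale_isLattice htne
  have hMC : ∀ v ∈ M, ‖v‖ ≤ ‖t‖ * C := by
    intro v hv
    have := hLC _ hv
    change ‖t⁻¹ • v‖ ≤ C at this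
    rwa [norm_smul, norm_inv, inv_mul_le_iff₀ ht0] at this
  have hMmul : ∀ v ∈ M, ∀ w ∈ M, (⟨(v : R) * w, hmul v v.2 w w.2⟩ : V) ∈ M := by
    intro v hv w hw
    rw [hMmem]
    refine hLδ _ ?_
    rw [norm_smul, norm_inv, inv_mul_lt_iff₀ ht0]
    calc ‖(v : R) * w‖ ≤ (‖t‖ * C) * (‖t‖ * C) := norm_mul_le_of_le (hMC v hv) (hMC w hw)
      _ = ‖t‖ * (‖t‖ * C ^ 2) := by ring
      _ < ‖t‖ * δ := by gcongr
  let D : R → Prop := fun y => ∃ v ∈ M, (v : R) = y - 1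
  have hD1 : D 1 := ⟨0, M.zero_mem, by simp⟩
  have hDmul : ∀ y z, D y → D z → D (y * z) := by
    rintro y z ⟨v, hv, hvy⟩ ⟨w, hw, hwz⟩
    refine ⟨⟨(v : R) * w, hmul v v.2 w w.2⟩ + v + w,
      add_mem (add_mem (hMmul v hv w hw) hv) hw, ?_⟩
    rw [Submodule.coe_add, Submodule.coe_add]
    change (v : R) * w + v + w = _
    rw [hvy, hwz]
    noncomm_ring
  have hDconj : ∀ (g : G) y, D y → D (conjRepresentation 𝕜 R g y) := by
    rintro g y ⟨v, hv, hvy⟩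
    refine ⟨⟨conjRepresentation 𝕜 R g v, hconj g v v.2⟩, ?_, ?_⟩
    · refine (hMmem _).2 (hLconj g _ ((hMmem v).1 hv) _ ?_)
      simp
    · change conjRepresentation 𝕜 R g v = _
      rw [hvy, map_sub]
      simp [conjRepresentation_apply]
  have hDnorm : ∀ y, D y → ‖y - 1‖ ≤ ‖t‖ * C := by
    rintro y ⟨v, hv, hvy⟩
    rw [← hvy]
    exact hMC v hv
  have hDnhds : ∀ᶠ x : G in 𝓝 1, D ((x : Rˣ) : R) := by
    obtain ⟨η, hη, hMη⟩ := hMlat.exists_ball_subset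
    have hc : Continuous fun x : G => ‖((x : Rˣ) : R) - 1‖ := (hind.continuous.sub continuous_const).norm
    have : ∀ᶠ x : G in 𝓝 1, ‖((x : Rˣ) : R) - 1‖ < η :=
      (hc.tendsto 1).eventually_lt_const (by simpa using hη)
    filter_upwards [this, hU] with x hx hxU
    exact ⟨⟨_, hxU⟩, hMη _ hx, rfl⟩
  -- The set `1 + t • L` is closed under products; requiring `x⁻¹` in it as well gives closure under
  -- inversion at once.
  let K : Subgroup G :=
    { carrier := {x | D ((x : Rˣ) : R) ∧ D (((x⁻¹ : G) : Rˣ) : R)}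
      one_mem' := by simpa using hD1
      mul_mem' := by
        rintro x y ⟨hx, hx'⟩ ⟨hy, hy'⟩
        refine ⟨by simpa using hDmul _ _ hx hy, by simpa using hDmul _ _ hy' hx'⟩
      inv_mem' := by
        rintro x ⟨hx, hx'⟩
        exact ⟨hx', by simpa using hx⟩ }
  have hKnhds : (K : Set G) ∈ 𝓝 1 := by
    have hinv : Tendsto (fun x : G => x⁻¹) (𝓝 1) (𝓝 1) := by
      simpa using (continuous_inv (G := G)).tendsto 1
    filter_upwards [hDnhds, hinv.eventually hDnhds] with x hx hx'
    exact ⟨hx, hx'⟩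
  have hKopen : IsOpen (K : Set G) := K.isOpen_of_mem_nhds hKnhds
  refine ⟨K, ⟨⟨fun x hx g => ?_⟩, hKopen, ?_⟩, fun x hx => ?_⟩
  · have h : ∀ z : G, conjRepresentation 𝕜 R g ((z : Rˣ) : R) = (((g * z * g⁻¹ : G) : Rˣ) : R) :=
      fun z => by simp [conjRepresentation_apply]
    refine ⟨h x ▸ hDconj g _ hx.1, ?_⟩
    have := h x⁻¹ ▸ hDconj g _ hx.2
    rwa [show g * x⁻¹ * g⁻¹ = (g * x * g⁻¹)⁻¹ by group] at this
  · have hcomp : IsCompact ((fun x : G => ((x : Rˣ) : R)) ⁻¹' Metric.closedBall 1 2⁻¹) := by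
      have h1 : IsCompact ((fun x : Rˣ => (x : R)) ⁻¹' Metric.closedBall 1 2⁻¹) :=
        Units.isOpenEmbedding_val.isInducing.isCompact_preimage' (isCompact_closedBall _ _)
          fun y hy => isUnit_of_norm_sub_one_lt_one
            ((mem_closedBall_iff_norm.1 hy).trans_lt (by norm_num))
      exact hG.isClosedEmbedding_subtypeVal.isCompact_preimage h1
    refine hcomp.of_isClosed_subset (K.isClosed_of_isOpen hKopen) fun x hx => ?_
    exact mem_closedBall_iff_norm.2 ((hDnorm _ hx.1).trans ht3.le)
  · exact hεO x ((hDnorm _ hx.1).trans_lt ht2)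

variable (𝕜) in
theorem hasBasis_nhds_one_normal_isOpen_isCompact [IsUltrametricDist 𝕜] [ProperSpace 𝕜]
    [FiniteDimensional 𝕜 R] (hG : IsClosed (G : Set Rˣ)) (hgen : IsCompactlyGeneratedGroup G)
    (hcontr : ∀ g : G, contractionSubgroup g = ⊥) :
    (𝓝 (1 : G)).HasBasis
      (fun K : Subgroup G => K.Normal ∧ IsOpen (K : Set G) ∧ IsCompact (K : Set G))
      (fun K => (K : Set G)) := by
  obtain ⟨U, hU, hmin⟩ := exists_nhds_spanSubOne_le 𝕜 G
  obtain ⟨L, hL, hLconj⟩ := exists_isLattice_conjRepresentation_mem hG hgen hcontr hU hmin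
  refine ⟨fun O => ⟨fun hO => ?_, fun ⟨K, hK, hKO⟩ => ?_⟩⟩
  · exact exists_normal_isOpen_isCompact_subset (V := spanSubOne 𝕜 U) hG
      (mem_of_superset hU fun x hx => sub_one_mem_spanSubOne hx)
      (fun v hv w hw => mul_mem_spanSubOne hU hmin hv hw)
      (fun g v hv => conjRepresentation_mem_spanSubOne hU hmin g hv) hL hLconj hO
  · exact mem_of_superset (hK.2.1.mem_nhds K.one_mem) hKO

end CompactOpenNormal

theorem proposition7 {F : Type*} [Field F] [ValuativeRel F] [TopologicalSpace F]
    [IsNonarchimedeanLocalField F] (n : ℕ)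
    (G : Subgroup (Matrix.GeneralLinearGroup (Fin n) F))
    (hclosed : IsClosed (G : Set (Matrix.GeneralLinearGroup (Fin n) F)))
    (hgen : IsCompactlyGeneratedGroup G)
    (hcontr : ∀ g : G, contractionSubgroup g = ⊥) :
    (𝓝 (1 : G)).HasBasis
      (fun K : Subgroup G => K.Normal ∧ IsOpen (K : Set G) ∧ IsCompact (K : Set G))
      (fun K => (K : Set G)) := by
  -- A rank-one embedding of the value group turns the valuation into a norm, and the operator norm
  -- makes the matrices a normed algebra.
  let := IsTopologicalAddGroup.rightUniformSpace F
  have := isUniformAddGroup_of_addCommGroup (G := F)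
  let : (Valued.v (R := F) (Γ₀ := ValuativeRel.ValueGroupWithZero F)).RankOne :=
  { hom' := ValuativeRel.IsRankLeOne.nonempty.some.emb (R := F).comp
        MonoidWithZeroHom.ValueGroup₀.embedding
    strictMono' := ValuativeRel.IsRankLeOne.nonempty.some.strictMono.comp
        MonoidWithZeroHom.ValueGroup₀.embedding_strictMono }
  let : NontriviallyNormedField F :=
    Valued.toNontriviallyNormedField (L := F) (Γ₀ := ValuativeRel.ValueGroupWithZero F)
  have : IsUltrametricDist F := inferInstance
  have : ProperSpace F := .of_nontriviallyNormedField_of_weaklyLocallyCompactSpace F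
  let := Matrix.linftyOpNormedRing (n := Fin n) (α := F)
  let := Matrix.linftyOpNormedAlgebra (n := Fin n) (R := F) (α := F)
  exact hasBasis_nhds_one_normal_isOpen_isCompact
    (R := Matrix (Fin n) (Fin n) F) F hclosed hgen hcontr
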